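/- Here $\mathbb N=\{1,2,3,\dots\}$. For $L\subseteq\mathbb N$ let $[L]^{<\omega}$ be the set of all finite subsets of $L$. For finite $s,t\subseteq\mathbb N$ write $s<t$ if every element of $s$ is smaller than every element of $t$. An initial segment of $I\subseteq\mathbb N$ is a finite set $s\subseteq I$ such that $x\in s$ whenever $x\in I$ and $x\le y$ for some $y\in s$. For $\mathcal F\subseteq[\mathbb N]^{<\omega}$ put $$\mathcal F^\star=\{t\in[\mathbb N]^{<\omega}: t\text{ is an initial segment of some } s\in\mathcal F\}\cup\{\emptyset\};$$ $\mathcal F$ is a *tree* if $\mathcal F^\star=\mathcal F$. For every countable non-zero limit ordinal $\lambda$ fix, arbitrarily, a strictly increasing sequence $(\lambda_n)_{n\ge1}$ of successor ordinals smaller than $\lambda$ with $\sup_n\lambda_n=\lambda$. The *complete thin Schreier system* $(\mathcal A_\xi)_{\xi<\omega_1}$ (for this choice of sequences) is defined by recursion, where $\omega^{\alpha}\cdot p$ denotes the sum of $p$ copies of $\omega^\alpha$: 1. $\mathcal A_0=\{\emptyset\}$. 2. $\mathcal A_{\zeta+1}=\{\{n\}\cup s: n\in\mathbb N,\ \{n\}<s,\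 s\in\mathcal A_\zeta\}$. 3. $\mathcal A_{\omega^{\beta+1}}=\{s_1\cup\dots\cup s_n: n=\min s_1,\ s_1<\dots<s_n,\ s_1,\dots,s_n\in\mathcal A_{\omega^\beta}\}$. 4. $\mathcal A_{\omega^\lambda}=\{s: s\ne\emptyset,\ s\in\mathcal A_{\omega^{\lambda_n}}\text{ with } n=\min s\}$ for a non-zero limit ordinal $\lambda$. 5. If $\xi$ is a limit ordinal with $\omega^{\alpha}<\xi<\omega^{\alpha+1}$ for some $\alpha>0$, write $\xi=\omega^{\alpha_0}\cdot p_0+\omega^{\alpha_1}\cdot p_1+\dots+\omega^{\alpha_m}\cdot p_m$ with $\alpha=\alpha_0>\alpha_1>\dots>\alpha_m>0$ and integers $p_0,\dots,p_m\ge1$ (so that $m\ge1$ or $p_0>1$). Then $\mathcal A_\xi$ consists of the sets $s_m\cup\dots\cup s_1\cup s_0$ with $s_m<\dots<s_1<s_0$, where each $s_i$ is a union $s^i_1\cup\dots\cup s^i_{p_i}$ with $s^i_1<\dots<s^i_{p_i}$ and $s^i_1,\dots,s^i_{p_i}\in\mathcal A_{\omega^{\alpha_i}}$. **Corollary 3.11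 (= Theorem C).** Let $\mathcal F$ be a tree of finite subsets of $\mathbb N$. Then there is an infinite set $L\subseteq\mathbb N$ such that - either (i) $[L]^{<\omega}\subseteq\mathcal F$; - or (ii) there is a countable ordinal $\xi_0$ such that every infinite $I\subseteq L$ has exactly one initial segment $s$ belonging to $\mathcal A_{\xi_0}$, and this $s$ satisfies $s\notin\mathcal F$. -/

import Mathlib

open Ordinal

namespace SchreierSystem

/-- `s < t` for finite sets of positive integers: every element of `s` is strictly below every
element of `t` (that is, `max s < min t` when both are non-empty). -/
def BlockLT (s t : Finset ℕ+) : Prop :=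
  ∀ x ∈ s, ∀ y ∈ t, x < y

/-- The finite set `s` is an initial segment of the (finite or infinite) set `I`. -/
def IsInitialSegment (s : Finset ℕ+) (I : Set ℕ+) : Prop :=
  (s : Set ℕ+) ⊆ I ∧ ∀ y ∈ s, ∀ x ∈ I, x ≤ y → x ∈ s

/-- `star F` consists of all initial segments of elements of `F`, together with `∅`. -/
def star (F : Set (Finset ℕ+)) : Set (Finset ℕ+) :=
  {t | ∃ s ∈ F, IsInitialSegment t (s : Set ℕ+)} ∪ {∅}

/-- A family `F` of finite sets is a tree if `star F = F`. -/
def IsTree (F : Set (Finset ℕ+)) : Prop :=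
  star F = F

/-- `c` assigns to every countable non-zero limit ordinal `l` a strictly increasing sequence
`c l 1 < c l 2 < ⋯` of successor ordinals smaller than `l` with supremum `l`
(the values of `c` at other ordinals play no role). -/
structure IsSequenceChoice (c : Ordinal.{0} → ℕ+ → Ordinal.{0}) : Prop where
  strictMono : ∀ l < ω₁, Order.IsSuccLimit l → StrictMono (c l)
  isSucc : ∀ l < ω₁, Order.IsSuccLimit l → ∀ n, ∃ μ, c l n = μ + 1
  lt : ∀ l < ω₁, Order.IsSuccLimit l → ∀ n, c l n < l
  isLUB : ∀ l < ω₁, Order.IsSuccLimit l → IsLUB (Set.range (c l)) l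

/-- `MemA c ξ s` says that `s` belongs to the thin Schreier family `𝒜_ξ`, built with the choice `c`
of sequences converging to limit ordinals. The five constructors are the five clauses of the
transfinite recursion on `ξ`. For each `ξ` at most one clause applies, and it refers only to
families with smaller index, so that this inductive predicate is the recursively defined system. -/
inductive MemA (c : Ordinal.{0} → ℕ+ → Ordinal.{0}) : Ordinal.{0} → Finset ℕ+ → Prop
  /-- `𝒜_0 = {∅}`. -/
  | zero : MemA c 0 ∅
  /-- `𝒜_(ζ+1)`: the sets `{n} ∪ s` with `{n} < s` and `s ∈ 𝒜_ζ`. -/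
  | succ (ζ : Ordinal.{0}) (n : ℕ+) (s : Finset ℕ+) (hs : MemA c ζ s) (hn : BlockLT {n} s) :
      MemA c (ζ + 1) ({n} ∪ s)
  /-- `𝒜_(ω^(β+1))`: the unions of `s_1 < ⋯ < s_n`, all in `𝒜_(ω^β)`, with `n = min s_1`
  (which is the least element of the union). -/
  | omegaSucc (β : Ordinal.{0}) (n : ℕ+) (s : Fin (n : ℕ) → Finset ℕ+)
      (hs : ∀ i, MemA c (ω ^ β) (s i))
      (hlt : ∀ i j, i < j → BlockLT (s i) (s j))
      (hmin : IsLeast (s ⟨0, n.pos⟩ : Set ℕ+) n) :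
      MemA c (ω ^ (β + 1)) (Finset.univ.biUnion s)
  /-- `𝒜_(ω^l)` for a non-zero limit ordinal `l`: the sets `s ∈ 𝒜_(ω^(l_n))` with `n = min s`. -/
  | omegaLimit (l : Ordinal.{0}) (hl : Order.IsSuccLimit l) (n : ℕ+) (s : Finset ℕ+)
      (hmin : IsLeast (s : Set ℕ+) n) (hs : MemA c (ω ^ (c l n)) s) :
      MemA c (ω ^ l) s
  /-- `𝒜_ξ` for a limit ordinal `ξ` that is not a power of `ω`, with Cantor normal form
  `ξ = ω^(a 0) * p 0 + ω^(a 1) * p 1 + ⋯ + ω^(a m) * p m`, where `a 0 > ⋯ > a m > 0`, `p i ≥ 1` and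
  either `m ≥ 1` or `p 0 > 1`. The members are the unions of blocks `t i j ∈ 𝒜_(ω^(a i))`
  (`0 ≤ i ≤ m`, `0 ≤ j < p i`), in increasing order of `j` for the same `i`, and with all blocks
  for larger `i` preceding all blocks for smaller `i`. -/
  | normalForm (m : ℕ) (a : Fin (m + 1) → Ordinal.{0}) (p : Fin (m + 1) → ℕ)
      (ha : StrictAnti a) (ha_pos : ∀ i, 0 < a i) (hp : ∀ i, 1 ≤ p i) (hne : 1 ≤ m ∨ 1 < p 0)
      (t : (i : Fin (m + 1)) → Fin (p i) → Finset ℕ+)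
      (ht : ∀ i j, MemA c (ω ^ (a i)) (t i j))
      (hlt : ∀ i j k, j < k → BlockLT (t i j) (t i k))
      (hlt' : ∀ i i' j k, i' < i → BlockLT (t i j) (t i' k)) :
      MemA c (List.ofFn fun i => ω ^ (a i) * (p i : Ordinal.{0})).sum
        (Finset.univ.biUnion fun i => Finset.univ.biUnion (t i))

/-- The family `𝒜_ξ` of the complete thin Schreier system built with the choice `c`. -/
def A (c : Ordinal.{0} → ℕ+ → Ordinal.{0}) (ξ : Ordinal.{0}) : Set (Finset ℕ+) :=
  {s | MemA c ξ s}

end SchreierSystem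

namespace SchreierSystem

/-! Galvin's lemma (`galvin`), applied to the complement of `F`, gives either alternative (i) or an
infinite `L` each of whose infinite subsets has an initial segment outside `F`. In the second case
`F` has no infinite branch inside `L`, so proper extension is well-founded there; as there are
countably many finite sets, the rank of `∅` is a countable ordinal, and `α` is taken to be its
successor.

The family `A c (ω ^ α)` is a front (`isFront_A_opow`). By `galvin` inside `L`, there is an infinite
`M ⊆ L` such that either no finite subset of `M` lies in both the front and `F`, and then `ξ₀ = ω ^
α` works, or every infinite subset of `M` has an initial segment in both. By uniqueness of initial
segments in a front, the latter puts every member of the front contained in `M` into `F`; then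
`le_rank` makes the rank of `∅` at least `α`, a contradiction. Only indices that are powers of `ω`
are needed. -/

/-- The elements of `I` lying strictly above the finite set `s`. -/
def above (s : Finset ℕ+) (I : Set ℕ+) : Set ℕ+ :=
  {y ∈ I | ∀ x ∈ s, x < y}

lemma above_subset (s : Finset ℕ+) (I : Set ℕ+) : above s I ⊆ I := fun _ h => h.1

lemma above_infinite (s : Finset ℕ+) {I : Set ℕ+} (hI : I.Infinite) : (above s I).Infinite := by
  have hfin : (⋃ x ∈ s, Set.Iic x).Finite :=
    s.finite_toSet.biUnion fun x _ => Set.finite_Iic x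
  refine (hI.sdiff hfin).mono fun y hy => ⟨hy.1, fun x hx => ?_⟩
  by_contra hle
  exact hy.2 (Set.mem_biUnion hx (not_lt.1 hle))

/-! ### Initial segments. -/

lemma IsInitialSegment.trans {s t : Finset ℕ+} {I : Set ℕ+}
    (hst : IsInitialSegment s (t : Set ℕ+)) (ht : IsInitialSegment t I) :
    IsInitialSegment s I :=
  ⟨hst.1.trans ht.1, fun y hy x hx hxy => hst.2 y hy x (ht.2 y (hst.1 hy) x hx hxy) hxy⟩

lemma IsInitialSegment.mono {s : Finset ℕ+} {I J : Set ℕ+} (h : IsInitialSegment s I)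
    (hs : (s : Set ℕ+) ⊆ J) (hJ : J ⊆ I) : IsInitialSegment s J :=
  ⟨hs, fun y hy x hx hxy => h.2 y hy x (hJ hx) hxy⟩

lemma isInitialSegment_union_left {s : Finset ℕ+} {I : Set ℕ+}
    (h : ∀ x ∈ s, ∀ y ∈ I, x < y) : IsInitialSegment s ((s : Set ℕ+) ∪ I) := by
  refine ⟨Set.subset_union_left, fun y hy x hx hxy => ?_⟩
  rcases hx with hx | hx
  · exact hx
  · exact absurd (h y hy x hx) (not_lt.2 hxy)

lemma isInitialSegment_union {s t : Finset ℕ+} {I : Set ℕ+} (hs : IsInitialSegment s I)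
    (ht : IsInitialSegment t (above s I)) : IsInitialSegment (s ∪ t) I := by
  refine ⟨?_, fun y hy x hx hxy => ?_⟩
  · rw [Finset.coe_union]
    exact Set.union_subset hs.1 (ht.1.trans (above_subset _ _))
  · rw [Finset.mem_union] at hy ⊢
    by_cases hxs : x ∈ s
    · exact Or.inl hxs
    · rcases hy with hy | hy
      · exact Or.inl (hs.2 y hy x hx hxy)
      · refine Or.inr (ht.2 y hy x ⟨hx, fun z hz => ?_⟩ hxy)
        by_contra hle
        exact hxs (hs.2 z hz x hx (not_lt.1 hle))

lemma IsInitialSegment.of_union {s t : Finset ℕ+} {I : Set ℕ+} (hst : BlockLT s t)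
    (h : IsInitialSegment (s ∪ t) I) :
    IsInitialSegment s I ∧ IsInitialSegment t (above s I) := by
  have hsub := h.1
  rw [Finset.coe_union, Set.union_subset_iff] at hsub
  refine ⟨IsInitialSegment.trans ?_ h, fun y hy => ⟨hsub.2 hy, fun x hx => hst x hx y hy⟩,
    fun y hy x hx hxy => ?_⟩
  · rw [Finset.coe_union]
    exact isInitialSegment_union_left hst
  · rcases Finset.mem_union.1 (h.2 y (Finset.mem_union_right _ hy) x hx.1 hxy) with hxs | hxt
    · exact absurd (hx.2 x hxs) (lt_irrefl _)
    · exact hxt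

lemma IsInitialSegment.isLeast {s : Finset ℕ+} {I : Set ℕ+} (h : IsInitialSegment s I)
    (hs : s.Nonempty) {n : ℕ+} (hn : IsLeast I n) : IsLeast (s : Set ℕ+) n := by
  obtain ⟨x, hx⟩ := hs
  exact ⟨h.2 x hx n hn.1 (hn.2 (h.1 hx)), fun y hy => hn.2 (h.1 hy)⟩

lemma exists_isLeast {I : Set ℕ+} (hI : I.Nonempty) : ∃ n, IsLeast I n :=
  ⟨WellFounded.min wellFounded_lt I hI, WellFounded.min_mem _ _ hI,
    fun _ hy => not_lt.1 (WellFounded.not_lt_min _ _ hy)⟩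

/-! ### Galvin's lemma -/

/-- Diagonalisation: a property of pairs (finite set, infinite set) which is dense and depends
hereditarily on the part of the infinite set above the finite one can be achieved simultaneously
for all finite subsets of one infinite set. -/
lemma exists_fusion (P : Finset ℕ+ → Set ℕ+ → Prop)
    (hmono : ∀ s M N, P s M → above s N ⊆ M → P s N)
    (hdense : ∀ s M, M.Infinite → ∃ N ⊆ M, N.Infinite ∧ P s N)
    {M : Set ℕ+} (hM : M.Infinite) :
    ∃ N ⊆ M, N.Infinite ∧ ∀ s : Finset ℕ+, (s : Set ℕ+) ⊆ N → P s N := by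
  have hfin : ∀ (T : Finset (Finset ℕ+)) (M : Set ℕ+), M.Infinite →
      ∃ N ⊆ M, N.Infinite ∧ ∀ s ∈ T, P s N := by
    intro T
    induction T using Finset.induction_on with
    | empty => exact fun M hM => ⟨M, subset_rfl, hM, by simp⟩
    | insert s T _ ih =>
      intro M hM
      obtain ⟨N, hNM, hN, hP⟩ := ih M hM
      obtain ⟨N', hN'N, hN', hP'⟩ := hdense s N hN
      refine ⟨N', hN'N.trans hNM, hN', fun t ht => ?_⟩
      rcases Finset.mem_insert.1 ht with rfl | ht
      · exact hP'
      · exact hmono t N N' (hP t ht) ((above_subset _ _).trans hN'N)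
  -- Only finitely many sets lie below `n`, so all of them can be treated before the next element is
  -- chosen.
  have hstep : ∀ M : {M : Set ℕ+ // M.Infinite}, ∃ (n : ℕ+) (N : {M : Set ℕ+ // M.Infinite}),
      n ∈ M.1 ∧ N.1 ⊆ M.1 ∧ (∀ x ∈ N.1, n < x) ∧ ∀ s ⊆ Finset.Iic n, P s N.1 := by
    rintro ⟨M, hM⟩
    obtain ⟨n, hn⟩ := hM.nonempty
    obtain ⟨N, hNM, hN, hP⟩ := hfin (Finset.Iic n).powerset _ (above_infinite {n} hM)
    exact ⟨n, ⟨N, hN⟩, hn, hNM.trans (above_subset _ _),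
      fun x hx => (hNM hx).2 n (Finset.mem_singleton_self n),
      fun s hs => hP s (Finset.mem_powerset.2 hs)⟩
  choose f g hf hg hfg hP using hstep
  obtain ⟨M₀, hM₀M, hM₀, hP₀⟩ := hdense ∅ M hM
  set S : ℕ → {M : Set ℕ+ // M.Infinite} := fun k => g^[k] ⟨M₀, hM₀⟩ with hS
  have hSsucc : ∀ k, S (k + 1) = g (S k) := fun k => Function.iterate_succ_apply' _ _ _
  have hanti : Antitone fun k => (S k).1 := antitone_nat_of_succ_le fun k => by
    rw [hSsucc]; exact hg _
  have hmem : ∀ j k, j < k → f (S k) ∈ (S (j + 1)).1 := fun j k hjk =>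
    hanti (Nat.succ_le_of_lt hjk) (hf _)
  have hlt : StrictMono fun k => f (S k) := strictMono_nat_of_lt_succ fun k => by
    refine hfg (S k) _ ?_
    rw [← hSsucc]; exact hf _
  have hsub : Set.range (fun k => f (S k)) ⊆ M₀ := by
    rintro _ ⟨k, rfl⟩
    exact hanti (Nat.zero_le k) (hf _)
  refine ⟨Set.range fun k => f (S k), hsub.trans hM₀M,
    Set.infinite_range_of_injective hlt.injective, fun s hs => ?_⟩
  rcases s.eq_empty_or_nonempty with rfl | hne
  · exact hmono _ _ _ hP₀ ((above_subset _ _).trans hsub)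
  -- If `max s` is the `k`-th chosen element, all later ones lie in `g (S k)`, which was made good
  -- for every subset of `Finset.Iic (max s)`.
  · obtain ⟨k, hk⟩ := hs (s.max'_mem hne)
    have hk : f (S k) = s.max' hne := hk
    refine hmono s (g (S k)).1 _ (hP (S k) s fun x hx => ?_) ?_
    · rw [Finset.mem_Iic, hk]
      exact s.le_max' x hx
    · rintro _ ⟨⟨j, rfl⟩, hj⟩
      have : f (S k) < f (S j) := hk ▸ hj _ (s.max'_mem hne)
      have := hmem k j (hlt.lt_iff_lt.1 this)
      rwa [hSsucc] at this

/-- `M` accepts `s` if every set `s ∪ I` with `I` an infinite subset of `M` above `s` has an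
initial segment in `G`. -/
def Accepts (G : Set (Finset ℕ+)) (s : Finset ℕ+) (M : Set ℕ+) : Prop :=
  ∀ I : Set ℕ+, I.Infinite → I ⊆ above s M →
    ∃ t ∈ G, IsInitialSegment t ((s : Set ℕ+) ∪ I)

/-- `M` rejects `s` if no infinite subset of `M` accepts `s`. -/
def Rejects (G : Set (Finset ℕ+)) (s : Finset ℕ+) (M : Set ℕ+) : Prop :=
  ∀ N ⊆ M, N.Infinite → ¬ Accepts G s N

lemma Accepts.mono {G : Set (Finset ℕ+)} {s : Finset ℕ+} {M N : Set ℕ+} (h : Accepts G s M)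
    (hN : above s N ⊆ M) : Accepts G s N :=
  fun I hI hIN => h I hI fun _ hx => ⟨hN (hIN hx), (hIN hx).2⟩

lemma Rejects.mono {G : Set (Finset ℕ+)} {s : Finset ℕ+} {M N : Set ℕ+} (h : Rejects G s M)
    (hN : above s N ⊆ M) : Rejects G s N := fun K hK hKinf hacc =>
  h (above s K) (fun _ hx => hN ⟨hK hx.1, hx.2⟩) (above_infinite s hKinf)
    (hacc.mono ((above_subset _ _).trans (above_subset _ _)))

/-- If `N` decides every finite subset of itself and rejects `s`, it accepts `s ∪ {n}` for only
finitely many `n` in `N` above `s`. -/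
lemma Rejects.finite_accepts {G : Set (Finset ℕ+)} {s : Finset ℕ+} {N : Set ℕ+}
    (h : Rejects G s N) : {n ∈ above s N | Accepts G (insert n s) N}.Finite := by
  by_contra hinf
  -- An infinite set of such `n` would itself accept `s`: for `I` inside it with minimum `n`, split
  -- `s ∪ I` as `insert n s` followed by the rest of `I`.
  refine h _ (fun x hx => hx.1.1) hinf fun I hI hIsub => ?_
  obtain ⟨n, hn⟩ := exists_isLeast hI.nonempty
  obtain ⟨t, htG, ht⟩ := (hIsub hn.1).1.2 (above {n} I) (above_infinite _ hI) fun x hx =>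
    ⟨(hIsub hx.1).1.1.1, fun y hy => by
      rcases Finset.mem_insert.1 hy with rfl | hy
      · exact hx.2 y (Finset.mem_singleton_self y)
      · exact (hIsub hx.1).2 y hy⟩
  refine ⟨t, htG, ?_⟩
  convert ht using 1
  ext x
  simp only [Set.mem_union, Finset.mem_coe, Finset.mem_insert, above, Set.mem_ofPred_eq,
    Finset.mem_singleton, forall_eq]
  constructor
  · rintro (hx | hx)
    · exact Or.inl (Or.inr hx)
    · rcases (hn.2 hx).eq_or_lt with rfl | hlt
      · exact Or.inl (Or.inl rfl)
      · exact Or.inr ⟨hx, hlt⟩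
  · rintro ((rfl | hx) | hx)
    · exact Or.inr hn.1
    · exact Or.inl hx
    · exact Or.inr hx.1

/-- **Galvin's lemma**: for every family `G` of finite sets, every infinite set has an infinite
subset `L` such that either no finite subset of `L` is in `G`, or every infinite subset of `L` has
an initial segment in `G`. -/
theorem galvin (G : Set (Finset ℕ+)) {M : Set ℕ+} (hM : M.Infinite) :
    ∃ L ⊆ M, L.Infinite ∧ ((∀ s : Finset ℕ+, (s : Set ℕ+) ⊆ L → s ∉ G) ∨
      ∀ I ⊆ L, I.Infinite → ∃ s ∈ G, IsInitialSegment s I) := by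
  obtain ⟨N, hNM, hN, hdec⟩ := exists_fusion (fun s M => Accepts G s M ∨ Rejects G s M)
    (fun s M N h hsub => h.imp (fun h => h.mono hsub) fun h => h.mono hsub)
    (fun s M hM => by
      by_cases h : Rejects G s M
      · exact ⟨M, subset_rfl, hM, Or.inr h⟩
      · simp only [Rejects, not_forall, not_not] at h
        obtain ⟨N, hNM, hN, hacc⟩ := h
        exact ⟨N, hNM, hN, Or.inl hacc⟩) hM
  rcases hdec ∅ (by simp) with hacc | hrej
  · refine ⟨N, hNM, hN, Or.inr fun I hIN hI => ?_⟩
    obtain ⟨t, htG, ht⟩ := hacc I hI fun x hx => ⟨hIN hx, by simp⟩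
    exact ⟨t, htG, by simpa using ht⟩
  -- A second fusion removes the finitely many bad `n` for each rejected `s`, so that rejection
  -- propagates from `∅` to all finite subsets of `L`.
  obtain ⟨L, hLN, hL, hP⟩ := exists_fusion
    (fun s M => Rejects G s N → ∀ n ∈ above s N, n ∈ M → ¬ Accepts G (insert n s) N)
    (fun s M K h hsub hs n hn hnK => h hs n hn (hsub ⟨hnK, hn.2⟩))
    (fun s M hM => by
      by_cases hs : Rejects G s N
      · exact ⟨M \ {n ∈ above s N | Accepts G (insert n s) N}, Set.sdiff_subset,
          hM.sdiff hs.finite_accepts, fun _ n hn hnM hacc => hnM.2 ⟨hn, hacc⟩⟩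
      · exact ⟨M, subset_rfl, hM, fun h => absurd h hs⟩) hN
  have hall : ∀ s : Finset ℕ+, (s : Set ℕ+) ⊆ L → Rejects G s N := by
    intro s
    induction s using Finset.induction_on_max with
    | empty => exact fun _ => hrej
    | insert n s hmax ih =>
      intro hs
      rw [Finset.coe_insert, Set.insert_subset_iff] at hs
      refine (hdec (insert n s) ?_).resolve_left
        (hP s hs.2 (ih hs.2) n ⟨hLN hs.1, hmax⟩ hs.1)
      rw [Finset.coe_insert]
      exact Set.insert_subset (hLN hs.1) (hs.2.trans hLN)
  refine ⟨L, hLN.trans hNM, hL, Or.inl fun s hs hsG => hall s hs N subset_rfl hN ?_⟩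
  exact fun I _ hI => ⟨s, hsG, isInitialSegment_union_left fun x hx y hy => (hI hy).2 x hx⟩


/-! ### Fronts -/

/-- `B` is a front if every infinite set has exactly one initial segment in `B`. -/
def IsFront (B : Set (Finset ℕ+)) : Prop :=
  ∀ I : Set ℕ+, I.Infinite → ∃! s, s ∈ B ∧ IsInitialSegment s I

/-- The unions `s ∪ t` with `s < t`, `s ∈ B` and `t ∈ C`. -/
def concat (B C : Set (Finset ℕ+)) : Set (Finset ℕ+) :=
  {u | ∃ s ∈ B, ∃ t ∈ C, BlockLT s t ∧ u = s ∪ t}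

/-- The unions of `k` successive members of `B`. -/
def blockPower (B : Set (Finset ℕ+)) : ℕ → Set (Finset ℕ+)
  | 0 => {∅}
  | k + 1 => concat (blockPower B k) B

lemma IsFront.concat {B C : Set (Finset ℕ+)} (hB : IsFront B) (hC : IsFront C) :
    IsFront (concat B C) := by
  intro I hI
  obtain ⟨s, ⟨hsB, hs⟩, hsu⟩ := hB I hI
  obtain ⟨t, ⟨htC, ht⟩, htu⟩ := hC (above s I) (above_infinite s hI)
  refine ⟨s ∪ t, ⟨⟨s, hsB, t, htC, fun x hx y hy => (ht.1 hy).2 x hx, rfl⟩,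
    isInitialSegment_union hs ht⟩, ?_⟩
  rintro _ ⟨⟨s', hs'B, t', ht'C, hlt, rfl⟩, hu⟩
  obtain ⟨hs', ht'⟩ := hu.of_union hlt
  obtain rfl := hsu s' ⟨hs'B, hs'⟩
  rw [htu t' ⟨ht'C, ht'⟩]

lemma IsFront.blockPower {B : Set (Finset ℕ+)} (hB : IsFront B) :
    ∀ k, IsFront (blockPower B k)
  | 0 => fun I _ => ⟨∅, ⟨rfl, by simp [IsInitialSegment]⟩, fun _ h => h.1⟩
  | k + 1 => (hB.blockPower k).concat hB

lemma mem_blockPower_iff {B : Set (Finset ℕ+)} {k : ℕ} {u : Finset ℕ+} :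
    u ∈ blockPower B k ↔ ∃ s : Fin k → Finset ℕ+, (∀ i, s i ∈ B) ∧
      (∀ i j, i < j → BlockLT (s i) (s j)) ∧ u = Finset.univ.biUnion s := by
  induction k generalizing u with
  | zero =>
    constructor
    · rintro rfl
      exact ⟨fun i => i.elim0, fun i => i.elim0, fun i => i.elim0, by simp⟩
    · rintro ⟨s, -, -, rfl⟩
      show _ = _
      simp
  | succ k ih =>
    have hunion : ∀ s : Fin (k + 1) → Finset ℕ+, Finset.univ.biUnion s =
        Finset.univ.biUnion (fun i : Fin k => s i.castSucc) ∪ s (Fin.last k) := fun s => by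
      ext x
      simp [Fin.exists_fin_succ']
    constructor
    · rintro ⟨v, hv, t, ht, hlt, rfl⟩
      obtain ⟨s, hsB, hs, rfl⟩ := ih.1 hv
      have hst : ∀ i, BlockLT (s i) t := fun i x hx y hy =>
        hlt x (Finset.mem_biUnion.2 ⟨i, Finset.mem_univ i, hx⟩) y hy
      refine ⟨Fin.snoc s t, fun i => ?_, fun i j hij => ?_, ?_⟩
      · cases i using Fin.lastCases with
        | last => simpa using ht
        | cast i => simpa using hsB i
      · cases j using Fin.lastCases with
        | last =>
          cases i using Fin.lastCases with
          | last => exact absurd hij (lt_irrefl _)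
          | cast i => simpa using hst i
        | cast j =>
          cases i using Fin.lastCases with
          | last => exact absurd hij (not_lt.2 (Fin.le_last _))
          | cast i => simpa using hs i j (Fin.castSucc_lt_castSucc_iff.1 hij)
      · rw [hunion]
        simp
    · rintro ⟨s, hsB, hs, rfl⟩
      refine ⟨_, ih.2 ⟨fun i => s i.castSucc, fun i => hsB _,
        fun i j hij => hs _ _ (Fin.castSucc_lt_castSucc_iff.2 hij), rfl⟩, s (Fin.last k), hsB _,
        fun x hx y hy => ?_, hunion s⟩
      obtain ⟨i, -, hi⟩ := Finset.mem_biUnion.1 hx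
      exact hs _ _ (Fin.castSucc_lt_last i) x hi y hy

lemma nonempty_of_mem_blockPower {B : Set (Finset ℕ+)} (hB : ∀ s ∈ B, s.Nonempty) {k : ℕ}
    (hk : 0 < k) {u : Finset ℕ+} (hu : u ∈ blockPower B k) : u.Nonempty := by
  obtain ⟨k, rfl⟩ := Nat.exists_eq_succ_of_ne_zero hk.ne'
  obtain ⟨s, -, t, ht, -, rfl⟩ := hu
  exact (hB t ht).mono Finset.subset_union_right

/-! ### The families indexed by powers of `ω` -/

lemma list_sum_lt_omega0_opow {b : Ordinal.{0}} {l : List Ordinal.{0}}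
    (h : ∀ x ∈ l, x < ω ^ b) : l.sum < ω ^ b := by
  induction l with
  | nil => simpa using opow_pos b omega0_pos
  | cons x l ih =>
    rw [List.sum_cons]
    exact isPrincipal_add_omega0_opow b (h x List.mem_cons_self)
      (ih fun y hy => h y (List.mem_cons_of_mem _ hy))

/-- A Cantor normal form with more than one term (counted with multiplicity) is not a power
of `ω`. -/
lemma normalForm_ne_omega0_opow (m : ℕ) (a : Fin (m + 1) → Ordinal.{0}) (p : Fin (m + 1) → ℕ)
    (ha : StrictAnti a) (hp : ∀ i, 1 ≤ p i) (hne : 1 ≤ m ∨ 1 < p 0) (α : Ordinal.{0}) :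
    (List.ofFn fun i => ω ^ (a i) * (p i : Ordinal.{0})).sum ≠ ω ^ α := by
  rw [List.ofFn_succ, List.sum_cons]
  set r := (List.ofFn fun i : Fin m => ω ^ (a i.succ) * (p i.succ : Ordinal.{0})).sum with hr
  have hr_lt : r < ω ^ (a 0) := list_sum_lt_omega0_opow fun x hx => by
    obtain ⟨i, rfl⟩ := (List.mem_ofFn' _ _).1 hx
    exact opow_mul_lt_opow (natCast_lt_omega0 _) (ha (Fin.succ_pos i))
  have hle : ω ^ (a 0) ≤ ω ^ (a 0) * (p 0 : Ordinal.{0}) :=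
    le_mul_of_one_le_right' (by exact_mod_cast hp 0)
  intro h
  have hα : a 0 ≤ α := by
    rw [← opow_le_opow_iff_right one_lt_omega0, ← h]
    exact hle.trans le_self_add
  -- Equal exponents force a zero tail and coefficient 1; a larger `α` is impossible because `ω ^ α`
  -- is closed under addition.
  rcases hα.eq_or_lt with rfl | hlt
  · have hx : ω ^ (a 0) * (p 0 : Ordinal.{0}) = ω ^ (a 0) :=
      le_antisymm (le_self_add.trans h.le) hle
    rcases hne with hm | hp0
    · have hr0 : r = 0 := by
        rw [hx] at h
        exact add_left_cancel (h.trans (add_zero _).symm)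
      obtain ⟨k, rfl⟩ := Nat.exists_eq_succ_of_ne_zero (Nat.one_le_iff_ne_zero.1 hm)
      rw [hr, List.ofFn_succ, List.sum_cons] at hr0
      have h1 : ω ^ (a (Fin.succ 0)) * (p (Fin.succ 0) : Ordinal.{0}) = 0 :=
        nonpos_iff_eq_zero.1 (le_self_add.trans hr0.le)
      rcases mul_eq_zero.1 h1 with h1 | h1
      · exact (opow_pos _ omega0_pos).ne' h1
      · have := hp (Fin.succ 0)
        rw [Nat.cast_eq_zero] at h1
        omega
    · have h1 : (p 0 : Ordinal.{0}) = 1 :=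
        mul_left_cancel₀ (opow_pos (a 0) omega0_pos).ne' (hx.trans (mul_one _).symm)
      rw [Nat.cast_eq_one] at h1
      omega
  · refine h.not_lt (isPrincipal_add_omega0_opow α (opow_mul_lt_opow (natCast_lt_omega0 _) hlt) ?_)
    exact hr_lt.trans ((opow_lt_opow_iff_right one_lt_omega0).2 hlt)

variable {c : Ordinal.{0} → ℕ+ → Ordinal.{0}}

lemma eq_empty_of_mem_A_zero {s : Finset ℕ+} (h : s ∈ A c 0) : s = ∅ := by
  have h : MemA c 0 s := h
  generalize hξ : (0 : Ordinal.{0}) = ξ at h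
  cases h with
  | zero => rfl
  | succ ζ n s hs hn => exact absurd hξ (zero_le.trans_lt (lt_add_one ζ)).ne
  | omegaSucc β n s hs hlt hmin => exact absurd hξ.symm (opow_pos _ omega0_pos).ne'
  | omegaLimit l hl n s hmin hs => exact absurd hξ.symm (opow_pos _ omega0_pos).ne'
  | normalForm m a p ha ha_pos hp hne t ht hlt hlt' =>
    rw [List.ofFn_succ, List.sum_cons] at hξ
    have h0 : ω ^ (a 0) * (p 0 : Ordinal.{0}) = 0 :=
      nonpos_iff_eq_zero.1 (le_self_add.trans hξ.symm.le)
    rcases mul_eq_zero.1 h0 with h0 | h0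
    · exact absurd h0 (opow_pos _ omega0_pos).ne'
    · have := hp 0
      rw [Nat.cast_eq_zero] at h0
      omega

/-- Inverts the recursion at a power of `ω`: the successor clause survives only for `α = 0`, since
`ω ^ α` is otherwise a limit, and the normal form clause never yields a power. -/
lemma mem_A_opow_cases {α : Ordinal.{0}} {s : Finset ℕ+} (h : s ∈ A c (ω ^ α)) :
    (α = 0 ∧ ∃ n, s = {n}) ∨
    (∃ (β : Ordinal.{0}) (n : ℕ+), α = β + 1 ∧ IsLeast (s : Set ℕ+) n ∧
      s ∈ blockPower (A c (ω ^ β)) n) ∨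
    (Order.IsSuccLimit α ∧ ∃ n, IsLeast (s : Set ℕ+) n ∧ s ∈ A c (ω ^ (c α n))) := by
  have h : MemA c (ω ^ α) s := h
  have hinj : ∀ {β γ : Ordinal.{0}}, ω ^ β = ω ^ γ → β = γ := fun h =>
    (opow_right_inj one_lt_omega0).1 h
  generalize hξ : ω ^ α = ξ at h
  cases h with
  | zero => exact absurd hξ (opow_pos α omega0_pos).ne'
  | succ ζ n s hs hn =>
    have hα : α = 0 := by
      by_contra hα
      have hlim : Order.IsSuccLimit (ω ^ α) := isSuccLimit_opow_left isSuccLimit_omega0 hα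
      rw [hξ] at hlim
      simp at hlim
    have hζ : ζ = 0 := by
      rw [hα, opow_zero] at hξ
      exact Order.add_one_inj.1 (hξ.symm.trans (zero_add 1).symm)
    subst hζ
    refine Or.inl ⟨hα, n, ?_⟩
    rw [eq_empty_of_mem_A_zero hs, Finset.union_empty]
  | omegaSucc β n s hs hlt hmin =>
    refine Or.inr (Or.inl ⟨β, n, hinj hξ, ⟨?_, fun x hx => ?_⟩,
      mem_blockPower_iff.2 ⟨s, hs, hlt, rfl⟩⟩)
    · exact Finset.mem_biUnion.2 ⟨_, Finset.mem_univ _, hmin.1⟩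
    · obtain ⟨i, -, hi⟩ := Finset.mem_biUnion.1 hx
      rcases Nat.eq_zero_or_pos i.1 with h0 | h0
      · exact hmin.2 (by rwa [show i = ⟨0, n.pos⟩ from Fin.ext h0] at hi)
      · exact (hlt ⟨0, n.pos⟩ i h0 n hmin.1 x hi).le
  | omegaLimit l hl n s hmin hs =>
    obtain rfl := hinj hξ
    exact Or.inr (Or.inr ⟨hl, n, hmin, hs⟩)
  | normalForm m a p ha ha_pos hp hne t ht hlt hlt' =>
    exact absurd hξ.symm (normalForm_ne_omega0_opow m a p ha hp hne α)

lemma nonempty_of_mem_A_opow {α : Ordinal.{0}} {s : Finset ℕ+} (h : s ∈ A c (ω ^ α)) :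
    s.Nonempty := by
  rcases mem_A_opow_cases h with ⟨-, n, rfl⟩ | ⟨-, n, -, hn, -⟩ | ⟨-, n, hn, -⟩
  · exact Finset.singleton_nonempty n
  · exact ⟨n, hn.1⟩
  · exact ⟨n, hn.1⟩

lemma mem_A_opow_zero_iff {s : Finset ℕ+} : s ∈ A c (ω ^ (0 : Ordinal.{0})) ↔ ∃ n, s = {n} := by
  constructor
  · intro h
    rcases mem_A_opow_cases h with ⟨-, hn⟩ | ⟨β, n, h0, -⟩ | ⟨h0, -⟩
    · exact hn
    · exact absurd h0 (zero_le.trans_lt (lt_add_one β)).ne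
    · exact absurd rfl h0.ne_bot
  · rintro ⟨n, rfl⟩
    have := MemA.succ (c := c) 0 n ∅ MemA.zero (by simp [BlockLT])
    rw [zero_add, Finset.union_empty] at this
    rwa [opow_zero]

lemma mem_A_opow_add_one_iff {β : Ordinal.{0}} {s : Finset ℕ+} :
    s ∈ A c (ω ^ (β + 1)) ↔
      ∃ n : ℕ+, IsLeast (s : Set ℕ+) n ∧ s ∈ blockPower (A c (ω ^ β)) n := by
  constructor
  · intro h
    rcases mem_A_opow_cases h with ⟨h0, -⟩ | ⟨γ, n, h0, hn, hs⟩ | ⟨h0, -⟩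
    · simp at h0
    · obtain rfl := Order.add_one_inj.1 h0
      exact ⟨n, hn, hs⟩
    · simp at h0
  · rintro ⟨n, hn, hs⟩
    obtain ⟨t, htA, ht, rfl⟩ := mem_blockPower_iff.1 hs
    refine MemA.omegaSucc β n t htA ht ?_
    have hsub : ∀ i, (t i : Set ℕ+) ⊆ (Finset.univ.biUnion t : Finset ℕ+) := fun i x hx =>
      Finset.mem_biUnion.2 ⟨i, Finset.mem_univ i, hx⟩
    refine ⟨?_, fun x hx => hn.2 (hsub _ hx)⟩
    -- The minimum lies in the first block because that block is nonempty and precedes the others.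
    obtain ⟨i, -, hi⟩ := Finset.mem_biUnion.1 hn.1
    rcases Nat.eq_zero_or_pos i.1 with h0 | h0
    · rwa [show i = ⟨0, n.pos⟩ from Fin.ext h0] at hi
    · obtain ⟨x, hx⟩ := nonempty_of_mem_A_opow (htA ⟨0, n.pos⟩)
      exact absurd (ht ⟨0, n.pos⟩ i h0 x hx n hi) (not_lt.2 (hn.2 (hsub _ hx)))

lemma mem_A_opow_limit_iff {l : Ordinal.{0}} (hl : Order.IsSuccLimit l) {s : Finset ℕ+} :
    s ∈ A c (ω ^ l) ↔ ∃ n : ℕ+, IsLeast (s : Set ℕ+) n ∧ s ∈ A c (ω ^ (c l n)) := by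
  constructor
  · intro h
    rcases mem_A_opow_cases h with ⟨rfl, -⟩ | ⟨γ, n, rfl, -⟩ | ⟨-, hs⟩
    · exact absurd rfl hl.ne_bot
    · simp at hl
    · exact hs
  · rintro ⟨n, hn, hs⟩
    exact MemA.omegaLimit l hl n s hn hs

/-- A nonempty initial segment of `I` has the same minimum as `I`, so on `I` the family `B` agrees
with the single front `C (min I)`. -/
lemma isFront_of_forall_isLeast {B : Set (Finset ℕ+)} {C : ℕ+ → Set (Finset ℕ+)}
    (hC : ∀ n, IsFront (C n)) (hne : ∀ n, ∀ s ∈ C n, s.Nonempty)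
    (hB : ∀ s, s ∈ B ↔ ∃ n : ℕ+, IsLeast (s : Set ℕ+) n ∧ s ∈ C n) : IsFront B := by
  intro I hI
  obtain ⟨n, hn⟩ := exists_isLeast hI.nonempty
  obtain ⟨s, ⟨hsC, hs⟩, hu⟩ := hC n I hI
  refine ⟨s, ⟨(hB s).2 ⟨n, hs.isLeast (hne n s hsC) hn, hsC⟩, hs⟩, ?_⟩
  rintro t ⟨htB, ht⟩
  obtain ⟨m, hm, htC⟩ := (hB t).1 htB
  obtain rfl := (ht.isLeast ⟨m, hm.1⟩ hn).unique hm
  exact hu t ⟨htC, ht⟩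

lemma isFront_A_opow (hc : IsSequenceChoice c) {α : Ordinal.{0}} (hα : α < ω₁) :
    IsFront (A c (ω ^ α)) := by
  induction α using limitRecOn with
  | zero =>
    intro I hI
    obtain ⟨n, hn⟩ := exists_isLeast hI.nonempty
    refine ⟨{n}, ⟨mem_A_opow_zero_iff.2 ⟨n, rfl⟩, by simpa using hn.1, fun y hy x hx hxy => ?_⟩, ?_⟩
    · rw [Finset.mem_singleton] at hy ⊢
      exact le_antisymm (hxy.trans hy.le) (hn.2 hx)
    · rintro s ⟨hs, hsI⟩
      obtain ⟨m, rfl⟩ := mem_A_opow_zero_iff.1 hs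
      have := (hsI.isLeast (Finset.singleton_nonempty m) hn).1
      rw [Finset.mem_coe, Finset.mem_singleton] at this
      rw [this]
  | add_one β ih =>
    have hβ := ih ((lt_add_one β).trans hα)
    exact isFront_of_forall_isLeast (C := fun n => blockPower (A c (ω ^ β)) n)
      (fun n => hβ.blockPower n)
      (fun n s hs => nonempty_of_mem_blockPower (fun _ => nonempty_of_mem_A_opow) n.pos hs)
      fun s => mem_A_opow_add_one_iff
  | limit l hl ih =>
    exact isFront_of_forall_isLeast (C := fun n => A c (ω ^ (c l n)))
      (fun n => ih _ (hc.lt l hα hl n) ((hc.lt l hα hl n).trans hα))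
      (fun n s hs => nonempty_of_mem_A_opow hs) fun s => mem_A_opow_limit_iff hl

/-! ### Comparison of ranks -/

/-- `t` is a proper end-extension of `s` in the family `F` restricted to `L`. -/
def ProperExtension (F : Set (Finset ℕ+)) (L : Set ℕ+) (t s : Finset ℕ+) : Prop :=
  t ∈ F ∧ (t : Set ℕ+) ⊆ L ∧ IsInitialSegment s (t : Set ℕ+) ∧ s ≠ t

lemma IsTree.mem_of_isInitialSegment {F : Set (Finset ℕ+)} (hF : IsTree F) {s t : Finset ℕ+}
    (ht : t ∈ F) (h : IsInitialSegment s (t : Set ℕ+)) : s ∈ F := by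
  rw [← (hF : star F = F)]
  exact Or.inl ⟨t, ht, h⟩

/-- The union of an infinite chain of extensions would be an infinite subset of `L` with all its
initial segments in `F`. -/
lemma IsTree.wellFounded_properExtension {F : Set (Finset ℕ+)} (hF : IsTree F) {L : Set ℕ+}
    (hL : ∀ I ⊆ L, I.Infinite → ∃ s ∉ F, IsInitialSegment s I) :
    WellFounded (ProperExtension F L) := by
  refine wellFounded_iff_isEmpty_descending_chain.2 ⟨?_⟩
  rintro ⟨f, hf⟩
  have hinit : ∀ j k, j ≤ k → IsInitialSegment (f j) (f k : Set ℕ+) := by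
    intro j k hjk
    induction k, hjk using Nat.le_induction with
    | base => exact ⟨subset_rfl, fun _ _ _ hx _ => hx⟩
    | succ k _ ih => exact ih.trans (hf k).2.2.1
  set I : Set ℕ+ := ⋃ k, (f k : Set ℕ+) with hI
  -- The relation places only the larger set in `F` and in `L`, so nothing is known of `f 0`
  -- directly and `f (k + 1)` is used.
  have hIL : I ⊆ L := Set.iUnion_subset fun k =>
    ((hinit k (k + 1) k.le_succ).1).trans (hf k).2.1
  have hinf : I.Infinite := by
    have hmono : StrictMono fun k => (f k : Set ℕ+) := strictMono_nat_of_lt_succ fun k =>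
      lt_of_le_of_ne (hf k).2.2.1.1 fun h => (hf k).2.2.2 (Finset.coe_injective h)
    intro hfin
    exact Set.infinite_of_injective_forall_mem hmono.injective
      (fun k => Set.subset_iUnion (fun k => (f k : Set ℕ+)) k) hfin.finite_subsets
  obtain ⟨s, hsF, hs⟩ := hL I hIL hinf
  have hk : ∃ k, (s : Set ℕ+) ⊆ f k := by
    have hdir : Directed (· ⊆ ·) fun k => (f k : Set ℕ+) :=
      directed_of_isDirected_le fun j k hjk => (hinit j k hjk).1
    exact hdir.exists_mem_subset_of_finset_subset_biUnion hs.1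
  obtain ⟨k, hk⟩ := hk
  refine hsF (hF.mem_of_isInitialSegment (hf k).1 (hs.mono ?_ ?_))
  · exact hk.trans (hinit k (k + 1) k.le_succ).1
  · exact Set.subset_iUnion (fun k => (f k : Set ℕ+)) (k + 1)

lemma rank_lt_omega_one {α : Type} [Countable α] (r : α → α → Prop) [IsWellFounded α r] (a : α) :
    IsWellFounded.rank r a < ω₁ := by
  induction a using IsWellFounded.induction r with
  | _ a ih =>
    rw [IsWellFounded.rank_eq]
    exact iSup_lt_omega_one fun b => (Cardinal.isSuccLimit_omega 1).succ_lt (ih b.1 b.2)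

lemma exists_mem_gt {L : Set ℕ+} (hL : L.Infinite) (m : ℕ+) : ∃ n ∈ L, m < n := by
  obtain ⟨n, hn⟩ := (above_infinite {m} hL).nonempty
  exact ⟨n, hn.1, hn.2 m (Finset.mem_singleton_self m)⟩

variable {F : Set (Finset ℕ+)} {L : Set ℕ+}

/-- If all `s ∪ t`, where `t` is a union of `n ≥ 2` successive members of `A_(ω ^ β)` with minimum
`n`, are in the tree `F`, then `s` has an extension to which the same applies with a single member
of `A_(ω ^ β)`. -/
lemma exists_properExtension_of_blockPower (hF : IsTree F) {β : Ordinal.{0}}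
    (hβ : IsFront (A c (ω ^ β))) {s : Finset ℕ+} {M : Set ℕ+} (hsL : (s : Set ℕ+) ⊆ L)
    (hML : M ⊆ L) (hM : M.Infinite) (hsM : ∀ x ∈ s, ∀ y ∈ M, x < y) {n : ℕ+} (hnM : n ∈ M)
    (hn : 1 < n)
    (h : ∀ t ∈ blockPower (A c (ω ^ β)) n, IsLeast (t : Set ℕ+) n → (t : Set ℕ+) ⊆ M →
      s ∪ t ∈ F) :
    ∃ (u : Finset ℕ+) (N : Set ℕ+), ProperExtension F L u s ∧ N ⊆ L ∧ N.Infinite ∧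
      (∀ x ∈ u, ∀ y ∈ N, x < y) ∧ ∀ t ∈ A c (ω ^ β), (t : Set ℕ+) ⊆ N → u ∪ t ∈ F := by
  have hn : 1 < (n : ℕ) := hn
  -- The first `k = n - 1` blocks are fixed as `v` and the last is left free; `1 < n` makes `v`
  -- nonempty, hence the extension proper.
  obtain ⟨k, hk⟩ : ∃ k, (n : ℕ) = k + 1 := ⟨n - 1, by omega⟩
  set K : Set ℕ+ := {y ∈ M | n ≤ y} with hK
  have hKinf : K.Infinite :=
    (above_infinite {n} hM).mono fun x hx => ⟨hx.1, (hx.2 n (Finset.mem_singleton_self n)).le⟩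
  have hnK : IsLeast K n := ⟨⟨hnM, le_rfl⟩, fun x hx => hx.2⟩
  obtain ⟨v, ⟨hv, hvK⟩, -⟩ := hβ.blockPower k K hKinf
  have hvne : v.Nonempty :=
    nonempty_of_mem_blockPower (fun _ => nonempty_of_mem_A_opow) (by omega) hv
  have hvM : (v : Set ℕ+) ⊆ M := fun x hx => (hvK.1 hx).1
  have hvn := hvK.isLeast hvne hnK
  have hext : ∀ t ∈ A c (ω ^ β), (t : Set ℕ+) ⊆ above v K → s ∪ v ∪ t ∈ F := by
    intro t ht htK
    rw [Finset.union_assoc]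
    refine h _ ?_ ⟨Finset.mem_union_left _ hvn.1, fun x hx => ?_⟩ ?_
    · rw [hk]
      exact ⟨v, hv, t, ht, fun x hx y hy => (htK hy).2 x hx, rfl⟩
    · rcases Finset.mem_union.1 hx with hx | hx
      · exact hvn.2 hx
      · exact (htK hx).1.2
    · rw [Finset.coe_union]
      exact Set.union_subset hvM fun x hx => (htK hx).1.1
  have hlt : ∀ x ∈ s ∪ v, ∀ y ∈ above v K, x < y := by
    intro x hx y hy
    rcases Finset.mem_union.1 hx with hx | hx
    · exact hsM x hx y hy.1.1
    · exact hy.2 x hx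
  obtain ⟨t, ⟨ht, htK⟩, -⟩ := hβ _ (above_infinite v hKinf)
  refine ⟨s ∪ v, above v K, ⟨hF.mem_of_isInitialSegment (hext t ht htK.1) ?_, ?_, ?_, ?_⟩,
    fun x hx => hML hx.1.1, above_infinite v hKinf, hlt, hext⟩
  · rw [Finset.coe_union (s ∪ v) t]
    exact isInitialSegment_union_left fun x hx y hy => hlt x hx y (htK.1 hy)
  · rw [Finset.coe_union]
    exact Set.union_subset hsL (hvM.trans hML)
  · rw [Finset.coe_union]
    exact isInitialSegment_union_left fun x hx y hy => hsM x hx y (hvM hy)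
  · intro heq
    have hns : n ∈ s := by
      rw [heq]
      exact Finset.mem_union_right _ hvn.1
    exact lt_irrefl _ (hsM n hns n hnM)

/-- If `s ∪ t` is in the tree `F` for all `t ∈ A_(ω ^ α)` contained in some infinite set above `s`,
then `s` has rank at least `α` in `F`. -/
lemma le_rank (hc : IsSequenceChoice c) (hF : IsTree F) [IsWellFounded _ (ProperExtension F L)]
    {α : Ordinal.{0}} (hα : α < ω₁) {s : Finset ℕ+} {M : Set ℕ+} (hsL : (s : Set ℕ+) ⊆ L)
    (hML : M ⊆ L) (hM : M.Infinite) (hsM : ∀ x ∈ s, ∀ y ∈ M, x < y)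
    (h : ∀ t ∈ A c (ω ^ α), (t : Set ℕ+) ⊆ M → s ∪ t ∈ F) :
    α ≤ IsWellFounded.rank (ProperExtension F L) s := by
  induction α using WellFoundedLT.induction generalizing s M with
  | ind α ih =>
  have key : ∀ β < α, ∀ n ∈ M, 1 < n →
      (∀ t ∈ blockPower (A c (ω ^ β)) n, IsLeast (t : Set ℕ+) n → (t : Set ℕ+) ⊆ M →
        s ∪ t ∈ F) → β + 1 ≤ IsWellFounded.rank (ProperExtension F L) s := by
    intro β hβα n hnM hn hβ
    obtain ⟨u, N, hu, hNL, hN, huN, hext⟩ := exists_properExtension_of_blockPower hF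
      (isFront_A_opow hc (hβα.trans hα)) hsL hML hM hsM hnM hn hβ
    rw [← Order.succ_eq_add_one, Order.succ_le_iff]
    exact (ih β hβα (hβα.trans hα) hu.2.1 hNL hN huN hext).trans_lt
      (IsWellFounded.rank_lt_of_rel hu)
  rcases zero_or_succ_or_isSuccLimit α with rfl | ⟨β, rfl⟩ | hl
  · exact zero_le
  · obtain ⟨n, hnM, hn⟩ := exists_mem_gt hM 1
    exact key β (lt_add_one β) n hnM hn fun t ht htn htM =>
      h t (mem_A_opow_add_one_iff.2 ⟨n, htn, ht⟩) htM
  · refine (hc.isLUB α hα hl).2 ?_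
    rintro _ ⟨m, rfl⟩
    -- Sets with minimum `n` fall under the exponent `c l n ≥ c l m`; as this is a successor `β +
    -- 1`, they are unions of `n` blocks and `key` applies.
    obtain ⟨n, hnM, hmn⟩ := exists_mem_gt hM m
    refine ((hc.strictMono α hα hl).monotone hmn.le).trans ?_
    obtain ⟨β, hβ⟩ := hc.isSucc α hα hl n
    have hlt := hc.lt α hα hl n
    rw [hβ] at hlt ⊢
    refine key β ((lt_add_one β).trans hlt) n hnM (one_le.trans_lt hmn)
      fun t ht htn htM => h t ((mem_A_opow_limit_iff hl).2 ⟨n, htn, ?_⟩) htM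
    rw [hβ]
    exact mem_A_opow_add_one_iff.2 ⟨n, htn, ht⟩

end SchreierSystem

/-! ### The dichotomy. -/

open SchreierSystem in
theorem corollary3p11 (c : Ordinal.{0} → ℕ+ → Ordinal.{0})
    (hc : SchreierSystem.IsSequenceChoice c)
    (F : Set (Finset ℕ+)) (hF : SchreierSystem.IsTree F) :
    ∃ L : Set ℕ+, L.Infinite ∧
      ((∀ s : Finset ℕ+, (s : Set ℕ+) ⊆ L → s ∈ F) ∨
        ∃ ξ₀ : Ordinal.{0}, ξ₀ < Ordinal.omega 1 ∧
          ∀ I : Set ℕ+, I ⊆ L → I.Infinite →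
            ∃ s : Finset ℕ+,
              SchreierSystem.IsInitialSegment s I ∧ s ∈ SchreierSystem.A c ξ₀ ∧ s ∉ F ∧
              ∀ t : Finset ℕ+, SchreierSystem.IsInitialSegment t I →
                t ∈ SchreierSystem.A c ξ₀ → t = s) := by
  obtain ⟨L, -, hL, hall | hnone⟩ := galvin Fᶜ Set.infinite_univ
  · exact ⟨L, hL, Or.inl fun s hs => not_not.1 (hall s hs)⟩
  have : IsWellFounded _ (ProperExtension F L) := ⟨hF.wellFounded_properExtension hnone⟩
  set α := IsWellFounded.rank (ProperExtension F L) ∅ + 1 with hα_def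
  have hα : α < ω₁ := by
    simpa using (Cardinal.isSuccLimit_omega 1).succ_lt (rank_lt_omega_one (ProperExtension F L) ∅)
  have hfront := isFront_A_opow hc hα
  obtain ⟨M, hML, hM, hall | hnone⟩ := galvin (A c (ω ^ α) ∩ F) hL
  · refine ⟨M, hM, Or.inr ⟨ω ^ α, isPrincipal_opow_omega 1 omega0_lt_omega_one hα,
      fun I hIM hI => ?_⟩⟩
    obtain ⟨s, ⟨hs, hsI⟩, hu⟩ := hfront I hI
    exact ⟨s, hsI, hs, fun hsF => hall s (hsI.1.trans hIM) ⟨hs, hsF⟩,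
      fun t htI ht => hu t ⟨ht, htI⟩⟩
  · refine absurd (le_rank hc hF (L := L) hα (s := ∅) (M := M) (by simp) hML hM (by simp) ?_)
      (not_le.2 (lt_add_one _))
    intro t ht htM
    rw [Finset.empty_union]
    have hinf := above_infinite t hM
    -- Both `t` and `s` are initial segments of `t ∪ above t M` in the front, so they coincide and
    -- `t ∈ F`.
    obtain ⟨s, ⟨hs, hsF⟩, hsI⟩ := hnone ((t : Set ℕ+) ∪ above t M)
      (Set.union_subset htM (above_subset _ _)) (hinf.mono Set.subset_union_right)
    rwa [(hfront _ (hinf.mono Set.subset_union_right)).unique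
      ⟨ht, isInitialSegment_union_left fun x hx y hy => hy.2 x hx⟩ ⟨hs, hsI⟩]
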